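/- Let $\mathcal X$ be a finite set and let $\mathcal S(\mathcal X)$ be the set of probability distributions ("states") on $\mathcal X$. For $\varrho,\sigma\in\mathcal S(\mathcal X)$ let $D_1(\varrho\|\sigma)=D(\varrho\|\sigma)=\sum_x\varrho(x)\log\frac{\varrho(x)}{\sigma(x)}$ be the relative entropy, $D^*_\infty(\varrho\|\sigma)=\inf\{\lambda\in\mathbb R:\varrho\le e^\lambda\sigma\}$ the max-relative entropy and, for $\alpha\in(1,\infty)$, $D^*_\alpha(\varrho\|\sigma)=\frac1{\alpha-1}\log\sum_x\varrho(x)^\alpha\sigma(x)^{1-\alpha}$ (for $\alpha\in[1,\infty]$ these are all $+\infty$ if $\operatorname{supp}\varrho\not\subseteq\operatorname{supp}\sigma$). For a set $S$ of states put $D(\varrho\|S)=\inf_{\sigma\in S}D(\varrho\|\sigma)$, $D^*_\infty(\varrho\|S)=\inf_{\sigma\in S}D^*_\infty(\varrho\|\sigma)$, and, for $r>0$, $$H^*_r(\varrho\|S)=\sup_{\sigma\in S}\ \sup_{\alpha\in[1,\infty]}\frac{\alpha-1}{\alpha}\bigl[r-D^*_\alpha(\varrho\|\sigma)\bigr],$$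 with $\frac{\alpha-1}{\alpha}:=1$ at $\alpha=\infty$ and $0\cdot(\pm\infty):=0$. Let $\overline{\mathrm{co}}(S)$ denote the closed convex hull of $S$. A test on $\mathcal X^n$ is a function $T_n:\mathcal X^n\to[0,1]$; for $\tau\in\mathcal S(\mathcal X^n)$ write $\tau(T_n)=\sum_{x\in\mathcal X^n}\tau(x)T_n(x)$. For a sequence of sets $S_n\subseteq\mathcal S(\mathcal X^n)$, the strong converse exponent of the simple i.i.d. null hypothesis $\varrho$ against the alternative $(S_n)_n$ is $$\mathrm{sc}_r(\varrho\|(S_n)_n)=\inf\Bigl\{\limsup_{n\to\infty}-\tfrac1n\log\varrho^{\otimes n}(T_n)\ :\ \liminf_{n\to\infty}-\tfrac1n\log\sup_{\sigma_n\in S_n}\sigma_n(T_n)\ge r\Bigr\},$$ where the infimum is over all sequences of tests $(T_n)_n$. For $S\subseteq\mathcal S(\mathcal X)$ this exponent is denoted by * $\mathrm{sc}_r(\varrho\|S)$ in the composite i.i.d. setting $S_n=\{\sigma^{\otimes n}:\sigma\in S\}$, and $\mathrm{sc}_r(\varrho\|\sigma)$ if $S=\{\sigma\}$; * $\mathrm{sc}^{\mathrm{av}}_r(\varrho\|S)$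 in the arbitrarily varying setting $S_n=\{\sigma_1\otimes\cdots\otimes\sigma_n:\sigma_1,\dots,\sigma_n\in S\}$; * $\mathrm{sc}^{\mathrm{adv}}_r(\varrho\|S)$ in the adversarial setting, where $S_n$ consists of all $x\mapsto\prod_{i=1}^n\sigma_i(x_i\mid x_1,\dots,x_{i-1})$ with $\sigma_i(\cdot\mid x_1,\dots,x_{i-1})\in S$ for every $i$ and every $x_1,\dots,x_{i-1}$. The relaxed exponent $\mathrm{sc}^{\{1\}}_r(\varrho\|S)$ is the infimum of $\limsup_n-\frac1n\log\varrho^{\otimes n}(T_n)$ over all test sequences such that $\liminf_n-\frac1n\log\sigma^{\otimes n}(T_n)\ge r$ for each $\sigma\in S$ separately. **Theorem.** Let $\mathcal X$ be a finite set, $\varrho\in\mathcal S(\mathcal X)$ and $S\subseteq\mathcal S(\mathcal X)$ with $D(\varrho\|S)<D^*_\infty(\varrho\|S)$. Then for every $r>0$ $$\begin{aligned}H^*_r(\varrho\|\overline{\mathrm{co}}(S))&=\sup_{\sigma\in\overline{\mathrm{co}}(S)}\mathrm{sc}_r(\varrho\|\sigma)=\mathrm{sc}^{\mathrm{adv}}_r(\varrho\|\overline{\mathrm{co}}(S))=\mathrm{sc}^{\mathrm{adv}}_r(\varrho\|S)\\&=\mathrm{sc}^{\mathrm{av}}_r(\varrho\|S)=\mathrm{sc}^{\mathrm{av}}_r(\varrho\|\overline{\mathrm{co}}(S))=\mathrm{sc}_r(\varrho\|\overline{\mathrm{co}}(S))=\mathrm{sc}^{\{1\}}_r(\varrho\|\overline{\mathrm{co}}(S)).\end{aligned}$$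 -/

import Mathlib

open Filter
open scoped ENNReal

noncomputable section

namespace CompositeTesting

/-! States on a finite set `X` are the elements of `stdSimplex ℝ X`; all logarithms are natural,
with `log 0 = -∞`, and exponents take values in `EReal`. -/

section Divergences

variable {X : Type*} [Fintype X]

/-- The closed convex hull of a set of states. -/
def cco (S : Set (X → ℝ)) : Set (X → ℝ) := closure (convexHull ℝ S)

/-- The support of `ρ` is contained in the support of `σ`. -/
def SuppLE (ρ σ : X → ℝ) : Prop := ∀ x, σ x = 0 → ρ x = 0

open Classical in
/-- The relative entropy `D(ρ‖σ)`. -/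
def relEntropy (ρ σ : X → ℝ) : EReal :=
  if SuppLE ρ σ then ((∑ x, ρ x * Real.log (ρ x / σ x) : ℝ) : EReal) else ⊤

/-- The max-relative entropy `D_∞(ρ‖σ) = inf {l ∈ ℝ : ρ ≤ e^l σ}` (which is `+∞` if there is no
such `l`). -/
def maxRelEntropy (ρ σ : X → ℝ) : EReal :=
  ⨅ (l : ℝ) (_ : ∀ x, ρ x ≤ Real.exp l * σ x), (l : EReal)

open Classical in
/-- `Q_α(ρ‖σ) = ∑ ρ^α σ^(1-α)`, equal to `+∞` if `α ≥ 1` and `supp ρ ⊈ supp σ`. -/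
def renyiQ (α : ℝ) (ρ σ : X → ℝ) : ℝ≥0∞ :=
  if α < 1 ∨ SuppLE ρ σ then ENNReal.ofReal (∑ x, ρ x ^ α * σ x ^ (1 - α)) else ⊤

open Classical in
/-- The Rényi `α`-divergence `D_α(ρ‖σ)` of order `α ∈ (0, +∞]`; it is the relative entropy at
`α = 1` and the max-relative entropy at `α = +∞`. -/
def renyiDiv (α : ℝ≥0∞) (ρ σ : X → ℝ) : EReal :=
  if α = 1 then relEntropy ρ σ
  else if α = ⊤ then maxRelEntropy ρ σ
  else (((α.toReal - 1)⁻¹ : ℝ) : EReal) * ENNReal.log (renyiQ α.toReal ρ σ)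

/-- The Rényi `α`-divergence `D_α(R‖S)` of two sets of states. -/
def renyiDivSet (α : ℝ≥0∞) (R S : Set (X → ℝ)) : EReal :=
  ⨅ ρ ∈ R, ⨅ σ ∈ S, renyiDiv α ρ σ

/-- The factor `(α - 1) / α`, equal to `1` at `α = +∞`. -/
def antiFactor (α : ℝ≥0∞) : ℝ :=
  if α = ⊤ then 1 else (α.toReal - 1) / α.toReal

/-- The Hoeffding anti-divergence
`H_r(ρ‖σ) = sup_{α ∈ [1, +∞]} (α - 1) / α * (r - D_α(ρ‖σ))`, with `0 * (±∞) = 0`. -/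
def hoeffdingAnti (r : ℝ) (ρ σ : X → ℝ) : EReal :=
  ⨆ (α : ℝ≥0∞) (_ : 1 ≤ α), (antiFactor α : EReal) * ((r : EReal) - renyiDiv α ρ σ)

/-- The Hoeffding anti-divergence of two sets of states. -/
def hoeffdingAntiSet (r : ℝ) (R S : Set (X → ℝ)) : EReal :=
  ⨆ ρ ∈ R, ⨆ σ ∈ S, hoeffdingAnti r ρ σ

end Divergences

section Testing

/-- The worst-case type I error of a test `T` (the probability of accepting the null hypothesis)
for the set `R` of states. -/
def typeI {Y : Type*} [Fintype Y] (R : Set (Y → ℝ)) (T : Y → ℝ) : ℝ≥0∞ :=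
  ⨆ ρ ∈ R, ENNReal.ofReal (∑ y, ρ y * (1 - T y))

/-- The worst-case type II error of a test `T` for the set `S` of states. -/
def typeII {Y : Type*} [Fintype Y] (S : Set (Y → ℝ)) (T : Y → ℝ) : ℝ≥0∞ :=
  ⨆ σ ∈ S, ENNReal.ofReal (∑ y, σ y * T y)

/-- `-(1 / n) log p`. -/
def rate (n : ℕ) (p : ℝ≥0∞) : EReal := (((n : ℝ)⁻¹ : ℝ) : EReal) * (-ENNReal.log p)

variable {X : Type*} [Fintype X]

/-- A sequence of (randomized) tests on `X^n`, `n ∈ ℕ`. -/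
def IsTestSeq (T : ∀ n : ℕ, (Fin n → X) → ℝ) : Prop :=
  ∀ n x, T n x ∈ Set.Icc (0 : ℝ) 1

/-- The strong converse exponent of the null hypothesis `(R n)` against the alternative
hypothesis `(S n)`, with type II error exponent `r`. -/
def sc (r : ℝ) (R S : ∀ n : ℕ, Set ((Fin n → X) → ℝ)) : EReal :=
  ⨅ (T : ∀ n : ℕ, (Fin n → X) → ℝ) (_ : IsTestSeq T)
    (_ : (r : EReal) ≤ liminf (fun n => rate n (typeII (S n) (T n))) atTop),
    limsup (fun n => rate n (1 - typeI (R n) (T n))) atTop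

/-- The relaxed strong converse exponent (`t = {1}`) for an alternative hypothesis given by a
family of sequences of states: the type II exponent is required to be at least `r` for each
member `j` of the family separately. -/
def scRelaxedAlt {J : Type*} (r : ℝ) (R : ∀ n : ℕ, Set ((Fin n → X) → ℝ))
    (σ : J → ∀ n : ℕ, (Fin n → X) → ℝ) : EReal :=
  ⨅ (T : ∀ n : ℕ, (Fin n → X) → ℝ) (_ : IsTestSeq T)
    (_ : (r : EReal) ≤ ⨅ j, liminf (fun n => rate n (typeII {σ j n} (T n))) atTop),
    limsup (fun n => rate n (1 - typeI (R n) (T n))) atTop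

/-- The i.i.d. state `σ^{⊗ n}`. -/
def tensorPow (σ : X → ℝ) (n : ℕ) : (Fin n → X) → ℝ := fun x => ∏ i, σ (x i)

/-- The composite i.i.d. hypothesis `{σ^{⊗ n} : σ ∈ S}`. -/
def iidSet (S : Set (X → ℝ)) (n : ℕ) : Set ((Fin n → X) → ℝ) :=
  {p | ∃ σ ∈ S, p = tensorPow σ n}

/-- The arbitrarily varying hypothesis `{σ_1 ⊗ ⋯ ⊗ σ_n : σ_1, …, σ_n ∈ S}`. -/
def avSet (S : Set (X → ℝ)) (n : ℕ) : Set ((Fin n → X) → ℝ) :=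
  {p | ∃ σ : Fin n → X → ℝ, (∀ i, σ i ∈ S) ∧ p = fun x => ∏ i, σ i (x i)}

/-- The adversarial hypothesis: all states of the form
`x ↦ ∏ i, σ_i(x_i | x_1, …, x_{i-1})` where `σ_i(· | x_1, …, x_{i-1}) ∈ S` for every `i` and
every history `x_1, …, x_{i-1}`. -/
def advSet (S : Set (X → ℝ)) (n : ℕ) : Set ((Fin n → X) → ℝ) :=
  {p | ∃ κ : ∀ i : Fin n, (Fin (i : ℕ) → X) → X → ℝ, (∀ i h, κ i h ∈ S) ∧
    p = fun x => ∏ i, κ i (fun j => x (Fin.castLE i.isLt.le j)) (x i)}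

end Testing

end CompositeTesting

end

/-!
Write `C = cco S`. All the quantities in question form a cycle of inequalities
`H_r(ρ‖C) ≤ sup_σ sc(σ) ≤ sc^{1}(C) ≤ sc(C) ≤ sc^av(C) ≤ sc^av(S) ≤ sc^adv(S) ≤ sc^adv(C)
≤ H_r(ρ‖C)`.
Most links only compare sets of states. Three carry content.

* `hoeffdingAnti_le_sc`: the converse for a simple alternative, by Hölder's inequality between
  the acceptance probabilities under `ρ^{⊗ n}` and `σ^{⊗ n}`.
* `typeII_avSet_cco_le`: the probability `σ_1 ⊗ ⋯ ⊗ σ_n (T)` is affine and continuous in each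
  factor, so its supremum does not change when the factors range over `C` instead of `S`.
* `sc_advSet_le_hoeffdingAntiSet`: achievability against the adversary. Let
  `φ(t, σ) = (α - 1) / α * (r - D_α(ρ‖σ))` with `α = 1 + t`, and let `(t, σ)` maximize `φ` over
  `[δ, A] × C`. Let `τ` be the normalization of `ρ ^ (1 + t) σ ^ (-t)`. The first-order condition
  in `σ` says that `τ / σ` has mean at most `1` under every member of the convex set `C`; hence
  `∏ i, τ (x i) / σ (x i)` has mean at most `1` under every adversarial strategy, being a
  supermartingale, and Markov's inequality bounds the type II error by about `exp (-n D(τ‖σ))`.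
  The first-order condition in `t` says that `D(τ‖σ) = r` if `t` is interior, and gives an
  inequality at the ends of the interval; it makes the cost `D(τ‖ρ) + (r - D(τ‖σ))⁺` equal to
  `φ(t, σ)` up to an error that vanishes as `δ → 0` and `A → ∞`.

The hypothesis `hD` is used through the existence of some `σ ∈ S` whose support contains that of
`ρ`.
-/

namespace CompositeTesting

section Tilting

variable {X : Type*} [Fintype X]

/-! ### Elementary inequalities -/

lemma nonneg_of_hasDerivAt_of_le_right {f : ℝ → ℝ} {f' a : ℝ} (hf : HasDerivAt f f' a)
    (h : ∀ᶠ x in nhdsWithin a (Set.Ioi a), f a ≤ f x) : 0 ≤ f' := by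
  have h1 := (hasDerivAt_iff_tendsto_slope.1 hf).mono_left
    (nhdsWithin_mono a (s := Set.Ioi a) fun x hx => ne_of_gt (Set.mem_Ioi.1 hx))
  refine ge_of_tendsto h1 ?_
  filter_upwards [h, self_mem_nhdsWithin] with x hx hax
  rw [slope_def_field]
  exact div_nonneg (sub_nonneg.2 hx) (sub_nonneg.2 (le_of_lt hax))

lemma nonpos_of_hasDerivAt_of_le_left {f : ℝ → ℝ} {f' a : ℝ} (hf : HasDerivAt f f' a)
    (h : ∀ᶠ x in nhdsWithin a (Set.Iio a), f a ≤ f x) : f' ≤ 0 := by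
  have h1 := (hasDerivAt_iff_tendsto_slope.1 hf).mono_left
    (nhdsWithin_mono a (s := Set.Iio a) fun x hx => ne_of_lt (Set.mem_Iio.1 hx))
  refine le_of_tendsto h1 ?_
  filter_upwards [h, self_mem_nhdsWithin] with x hx hax
  rw [slope_def_field]
  exact div_nonpos_of_nonneg_of_nonpos (sub_nonneg.2 hx) (sub_nonpos.2 (le_of_lt hax))

/-- The relative entropy `∑ τ log (τ / σ)` as a real number; it is meaningful when `SuppLE τ σ`. -/
noncomputable def klSum (τ σ : X → ℝ) : ℝ := ∑ x, τ x * Real.log (τ x / σ x)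

lemma sub_le_mul_log_div {a b : ℝ} (ha : 0 ≤ a) (hb : 0 ≤ b) (h : b = 0 → a = 0) :
    a - b ≤ a * Real.log (a / b) := by
  rcases ha.eq_or_lt with rfl | ha
  · simpa using hb
  have hb : 0 < b := hb.lt_of_ne' fun h' => ha.ne' (h h')
  have h1 := Real.one_sub_inv_le_log_of_pos (div_pos ha hb)
  have h2 := mul_le_mul_of_nonneg_left h1 ha.le
  have h3 : a * (1 - (a / b)⁻¹) = a - b := by field_simp
  linarith

lemma klSum_nonneg {τ σ : X → ℝ} (hτ : τ ∈ stdSimplex ℝ X) (hσ : σ ∈ stdSimplex ℝ X)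
    (h : SuppLE τ σ) : 0 ≤ klSum τ σ := by
  have h1 : ∑ x, (τ x - σ x) ≤ klSum τ σ :=
    Finset.sum_le_sum fun x _ => sub_le_mul_log_div (hτ.1 x) (hσ.1 x) (h x)
  rw [Finset.sum_sub_distrib, hτ.2, hσ.2] at h1
  linarith

/-- A bound on the relative entropy `D(ρ‖σ)` keeps `σ` away from `0` on the support of `ρ`. -/
lemma le_of_klSum_le {ρ σ : X → ℝ} (hρ : ρ ∈ stdSimplex ℝ X) (hσ : σ ∈ stdSimplex ℝ X)
    (h : SuppLE ρ σ) {M : ℝ} (hM : klSum ρ σ ≤ M) (x : X) :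
    ρ x * Real.exp (-((M + 1) / ρ x)) ≤ σ x := by
  classical
  rcases (hρ.1 x).eq_or_lt with h0 | h0
  · rw [← h0]; simpa using hσ.1 x
  have hσx : 0 < σ x := (hσ.1 x).lt_of_ne' fun h' => h0.ne' (h x h')
  have h1 : ρ x * Real.log (ρ x / σ x) + ∑ y ∈ Finset.univ.erase x, (ρ y - σ y) ≤ klSum ρ σ := by
    rw [klSum, ← Finset.add_sum_erase _ _ (Finset.mem_univ x)]
    gcongr with y _
    exact sub_le_mul_log_div (hρ.1 y) (hσ.1 y) (h y)
  have h2 : -1 ≤ ∑ y ∈ Finset.univ.erase x, (ρ y - σ y) := by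
    have h3 : ∑ y ∈ Finset.univ.erase x, σ y ≤ 1 := by
      rw [← hσ.2]
      exact Finset.sum_le_sum_of_subset_of_nonneg (Finset.erase_subset _ _) fun y _ _ => hσ.1 y
    have h4 : 0 ≤ ∑ y ∈ Finset.univ.erase x, ρ y := Finset.sum_nonneg fun y _ => hρ.1 y
    rw [Finset.sum_sub_distrib]; linarith
  have h5 : Real.log (ρ x / σ x) ≤ (M + 1) / ρ x := by
    rw [le_div_iff₀ h0]; linarith
  have h6 : ρ x / σ x ≤ Real.exp ((M + 1) / ρ x) :=
    (Real.log_le_iff_le_exp (div_pos h0 hσx)).1 h5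
  rw [Real.exp_neg, ← div_eq_mul_inv, div_le_iff₀ (Real.exp_pos _), mul_comm]
  exact (div_le_iff₀ hσx).1 h6

/-! ### Tilted states -/

/-- The sum `∑ ρ (ρ / σ) ^ t = ∑ ρ ^ (1 + t) σ ^ (-t)`, written with exponentials so that it is
smooth in `t`; it is the Rényi quantity of order `1 + t` when `SuppLE ρ σ`. -/
noncomputable def tiltSum (ρ σ : X → ℝ) (t : ℝ) : ℝ :=
  ∑ x, ρ x * Real.exp (t * Real.log (ρ x / σ x))

/-- The normalized state proportional to `ρ ^ (1 + t) σ ^ (-t)`. -/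
noncomputable def tilt (ρ σ : X → ℝ) (t : ℝ) (x : X) : ℝ :=
  ρ x * Real.exp (t * Real.log (ρ x / σ x)) / tiltSum ρ σ t

/-- The quantity `(α - 1) / α * (r - D_α(ρ‖σ))` at `α = 1 + t`, as a real number. -/
noncomputable def antiObjective (ρ : X → ℝ) (r t : ℝ) (σ : X → ℝ) : ℝ :=
  (t * r - Real.log (tiltSum ρ σ t)) / (1 + t)

lemma tiltSum_pos {ρ : X → ℝ} (hρ : ρ ∈ stdSimplex ℝ X) (σ : X → ℝ) (t : ℝ) :
    0 < tiltSum ρ σ t := by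
  by_contra! h
  have h0 : ∀ x ∈ Finset.univ, 0 ≤ ρ x * Real.exp (t * Real.log (ρ x / σ x)) :=
    fun x _ => mul_nonneg (hρ.1 x) (Real.exp_pos _).le
  have h1 := (Finset.sum_eq_zero_iff_of_nonneg h0).1 (le_antisymm h (Finset.sum_nonneg h0))
  have h2 : ∑ x, ρ x = 0 := Finset.sum_eq_zero fun x hx =>
    (mul_eq_zero.1 (h1 x hx)).resolve_right (Real.exp_pos _).ne'
  rw [hρ.2] at h2
  exact one_ne_zero h2

lemma tilt_mem {ρ : X → ℝ} (hρ : ρ ∈ stdSimplex ℝ X) (σ : X → ℝ) (t : ℝ) :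
    tilt ρ σ t ∈ stdSimplex ℝ X := by
  refine ⟨fun x => div_nonneg (mul_nonneg (hρ.1 x) (Real.exp_pos _).le)
    (tiltSum_pos hρ σ t).le, ?_⟩
  simp only [tilt]
  rw [← Finset.sum_div]
  exact div_self (tiltSum_pos hρ σ t).ne'

lemma tilt_pos {ρ : X → ℝ} (hρ : ρ ∈ stdSimplex ℝ X) (σ : X → ℝ) (t : ℝ) {x : X} (hx : 0 < ρ x) :
    0 < tilt ρ σ t x :=
  div_pos (mul_pos hx (Real.exp_pos _)) (tiltSum_pos hρ σ t)

/-- Jensen's inequality: the Rényi divergence of order `1 + t` is at least the relative entropy. -/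
lemma mul_klSum_le_log_tiltSum {ρ : X → ℝ} (hρ : ρ ∈ stdSimplex ℝ X) (σ : X → ℝ) (t : ℝ) :
    t * klSum ρ σ ≤ Real.log (tiltSum ρ σ t) := by
  set m := t * klSum ρ σ with hm
  rw [Real.le_log_iff_exp_le (tiltSum_pos hρ σ t)]
  have h1 : ∀ x ∈ Finset.univ, Real.exp m * (ρ x + t * (ρ x * Real.log (ρ x / σ x)) - ρ x * m) ≤
      ρ x * Real.exp (t * Real.log (ρ x / σ x)) := fun x _ => by
    have h2 := mul_le_mul_of_nonneg_left (Real.add_one_le_exp (t * Real.log (ρ x / σ x) - m))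
      (mul_nonneg (hρ.1 x) (Real.exp_pos m).le)
    have h3 : Real.exp (t * Real.log (ρ x / σ x)) =
      Real.exp m * Real.exp (t * Real.log (ρ x / σ x) - m) := by rw [← Real.exp_add]; ring_nf
    rw [h3]
    linarith
  have h4 := Finset.sum_le_sum h1
  rw [← Finset.mul_sum, Finset.sum_sub_distrib, Finset.sum_add_distrib, ← Finset.mul_sum,
    ← Finset.sum_mul, hρ.2] at h4
  change Real.exp m * (1 + t * klSum ρ σ - 1 * m) ≤ tiltSum ρ σ t at h4
  rw [← hm] at h4
  linarith

lemma tilt_mul_log_div_left {ρ σ : X → ℝ} (hρ : ρ ∈ stdSimplex ℝ X) (t : ℝ) (x : X) :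
    tilt ρ σ t x * Real.log (tilt ρ σ t x / ρ x) =
      tilt ρ σ t x * (t * Real.log (ρ x / σ x) - Real.log (tiltSum ρ σ t)) := by
  rcases (hρ.1 x).eq_or_lt with h0 | h0
  · simp [tilt, ← h0]
  congr 1
  have h1 : tilt ρ σ t x / ρ x =
      Real.exp (t * Real.log (ρ x / σ x)) / tiltSum ρ σ t := by
    unfold tilt; field_simp
  rw [h1, Real.log_div (Real.exp_pos _).ne' (tiltSum_pos hρ σ t).ne', Real.log_exp]

lemma tilt_mul_log_div_right {ρ σ : X → ℝ} (hρ : ρ ∈ stdSimplex ℝ X)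
    (h : SuppLE ρ σ) (t : ℝ) (x : X) :
    tilt ρ σ t x * Real.log (tilt ρ σ t x / σ x) =
      tilt ρ σ t x * ((1 + t) * Real.log (ρ x / σ x) - Real.log (tiltSum ρ σ t)) := by
  rcases (hρ.1 x).eq_or_lt with h0 | h0
  · simp [tilt, ← h0]
  have hσ : σ x ≠ 0 := fun h' => h0.ne' (h x h')
  have h1 := tilt_mul_log_div_left (σ := σ) hρ t x
  have hτ := tilt_pos hρ σ t h0
  have h2 := mul_left_cancel₀ hτ.ne' h1
  have h3 : tilt ρ σ t x / σ x = tilt ρ σ t x / ρ x * (ρ x / σ x) := by field_simp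
  rw [h3, Real.log_mul (div_pos hτ h0).ne' (div_ne_zero h0.ne' hσ), h2]
  ring

lemma klSum_tilt_left {ρ σ : X → ℝ} (hρ : ρ ∈ stdSimplex ℝ X) (t : ℝ) :
    klSum (tilt ρ σ t) ρ =
      t * ∑ x, tilt ρ σ t x * Real.log (ρ x / σ x) - Real.log (tiltSum ρ σ t) := by
  simp only [klSum, tilt_mul_log_div_left hρ, mul_sub, Finset.sum_sub_distrib]
  rw [← Finset.sum_mul, (tilt_mem hρ σ t).2, one_mul, Finset.mul_sum]
  simp only [mul_left_comm]

lemma klSum_tilt_right {ρ σ : X → ℝ} (hρ : ρ ∈ stdSimplex ℝ X)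
    (h : SuppLE ρ σ) (t : ℝ) :
    klSum (tilt ρ σ t) σ =
      (1 + t) * ∑ x, tilt ρ σ t x * Real.log (ρ x / σ x) - Real.log (tiltSum ρ σ t) := by
  simp only [klSum, tilt_mul_log_div_right hρ h, mul_sub, Finset.sum_sub_distrib]
  rw [← Finset.sum_mul, (tilt_mem hρ σ t).2, one_mul, Finset.mul_sum]
  simp only [mul_left_comm]

/-- The derivative of the objective in the order vanishes exactly when the tilted state has
relative entropy `r` to `σ`. -/
lemma hasDerivAt_antiObjective {ρ σ : X → ℝ} (hρ : ρ ∈ stdSimplex ℝ X)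
    (h : SuppLE ρ σ) (r : ℝ) {t : ℝ} (ht : 0 < t) :
    HasDerivAt (fun t => antiObjective ρ r t σ)
      ((r - klSum (tilt ρ σ t) σ) / (1 + t) ^ 2) t := by
  have hZ := tiltSum_pos hρ σ t
  have h1 : HasDerivAt (fun t => tiltSum ρ σ t)
      (∑ x, ρ x * (Real.exp (t * Real.log (ρ x / σ x)) * Real.log (ρ x / σ x))) t := by
    unfold tiltSum
    refine HasDerivAt.fun_sum fun x _ => HasDerivAt.const_mul _ ?_
    simpa using ((hasDerivAt_id t).mul_const (Real.log (ρ x / σ x))).exp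
  have h2 := h1.log hZ.ne'
  have h3 : (∑ x, ρ x * (Real.exp (t * Real.log (ρ x / σ x)) * Real.log (ρ x / σ x))) /
      tiltSum ρ σ t = ∑ x, tilt ρ σ t x * Real.log (ρ x / σ x) := by
    rw [Finset.sum_div]
    exact Finset.sum_congr rfl fun x _ => by unfold tilt; ring
  rw [h3] at h2
  have h4 := (((hasDerivAt_id t).mul_const r).sub h2).div ((hasDerivAt_id t).const_add 1)
    (by simp only [id]; linarith)
  refine HasDerivAt.congr_deriv (f := fun t => antiObjective ρ r t σ) h4 ?_
  rw [klSum_tilt_right hρ h]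
  simp only [id, Pi.sub_apply]
  congr 1
  ring

/-- First-order optimality in the second argument: if moving `σ` towards `σ'` does not decrease
the Rényi sum, then the likelihood ratio `τ / σ` of the tilted state has `σ'`-mean at most `1`. -/
lemma sum_mul_tilt_div_le_one {ρ σ σ' : X → ℝ} (hρ : ρ ∈ stdSimplex ℝ X)
    (h : SuppLE ρ σ) {t : ℝ} (ht : 0 < t)
    (hmin : ∀ l : ℝ, 0 < l → l < 1 →
      tiltSum ρ σ t ≤ tiltSum ρ (fun x => (1 - l) * σ x + l * σ' x) t) :
    ∑ x, σ' x * (tilt ρ σ t x / σ x) ≤ 1 := by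
  have hZ := tiltSum_pos hρ σ t
  set Z := tiltSum ρ σ t with hZdef
  have h1 : HasDerivAt (fun l : ℝ => tiltSum ρ (fun x => (1 - l) * σ x + l * σ' x) t)
      (∑ x, -(t * Z) * (σ' x * (tilt ρ σ t x / σ x) - tilt ρ σ t x)) 0 := by
    unfold tiltSum
    refine HasDerivAt.fun_sum fun x _ => ?_
    rcases (hρ.1 x).eq_or_lt with h0 | h0
    · simpa [tilt, ← h0] using hasDerivAt_const (0 : ℝ) (0 : ℝ)
    have hσ : σ x ≠ 0 := fun h' => h0.ne' (h x h')
    have h2 : HasDerivAt (fun l : ℝ => (1 - l) * σ x + l * σ' x) (σ' x - σ x) 0 := by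
      have := (((hasDerivAt_id (0 : ℝ)).const_sub 1).mul_const (σ x)).add
        ((hasDerivAt_id (0 : ℝ)).mul_const (σ' x))
      exact this.congr_deriv (by ring)
    have h3 : HasDerivAt (fun l : ℝ => ρ x / ((1 - l) * σ x + l * σ' x))
        (-(ρ x * (σ' x - σ x)) / σ x ^ 2) 0 := by
      have := (hasDerivAt_const (0 : ℝ) (ρ x)).div h2 (by simpa using hσ)
      exact this.congr_deriv (by simp)
    have h4 := (((h3.log (by simpa using ⟨h0.ne', hσ⟩)).const_mul t).exp).const_mul (ρ x)
    refine h4.congr_deriv ?_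
    simp only [sub_zero, one_mul, zero_mul, add_zero, tilt, ← hZdef]
    field_simp
  have h2 := nonneg_of_hasDerivAt_of_le_right h1 (by
    filter_upwards [Ioo_mem_nhdsGT (zero_lt_one' ℝ)] with l hl
    simpa using hmin l hl.1 hl.2)
  rw [← Finset.mul_sum, Finset.sum_sub_distrib, (tilt_mem hρ σ t).2] at h2
  have h3 : 0 < t * Z := mul_pos ht hZ
  by_contra! h4
  nlinarith

/-! ### The optimal tilted state -/

lemma continuousOn_antiObjective {ρ : X → ℝ} (hρ : ρ ∈ stdSimplex ℝ X) (r : ℝ)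
    {s : Set (ℝ × (X → ℝ))} (hs : ∀ p ∈ s, 0 < p.1 ∧ SuppLE ρ p.2) :
    ContinuousOn (fun p : ℝ × (X → ℝ) => antiObjective ρ r p.1 p.2) s := by
  have h1 : ContinuousOn (fun p : ℝ × (X → ℝ) => tiltSum ρ p.2 p.1) s := by
    unfold tiltSum
    refine continuousOn_finsetSum _ fun x _ => ?_
    rcases (hρ.1 x).eq_or_lt with h0 | h0
    · simpa [← h0] using continuousOn_const
    have h2 : ContinuousOn (fun p : ℝ × (X → ℝ) => p.2 x) s := by fun_prop
    refine continuousOn_const.mul (Real.continuous_exp.comp_continuousOn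
      (continuousOn_fst.mul (ContinuousOn.log (continuousOn_const.div h2 ?_) ?_)))
    · exact fun p hp h' => h0.ne' ((hs p hp).2 x h')
    · exact fun p hp => div_ne_zero h0.ne' fun h' => h0.ne' ((hs p hp).2 x h')
  exact ((continuousOn_fst.mul continuousOn_const).sub
    (h1.log fun p _ => (tiltSum_pos hρ _ _).ne')).div (continuousOn_const.add continuousOn_fst)
    fun p hp => by have := (hs p hp).1; linarith

/-- If all values of the objective on a compact convex set `C` of states are at most `h`, then
there is a state `τ`, with a `σ ∈ C` for which `τ / σ` has mean at most `1` under every member of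
`C`, such that `D(τ‖ρ) + (r - D(τ‖σ))⁺` is at most `h` up to an arbitrarily small error. The state
`τ` is tilted from a maximizer `(t, σ)` of the objective over `[δ, A] × C`. -/
theorem exists_tilted_state {ρ : X → ℝ} (hρ : ρ ∈ stdSimplex ℝ X) {C : Set (X → ℝ)}
    (hC : C ⊆ stdSimplex ℝ X) (hcomp : IsCompact C) (hconv : Convex ℝ C)
    {σ₀ : X → ℝ} (hσ₀ : σ₀ ∈ C) (hsupp₀ : SuppLE ρ σ₀) {r h : ℝ} (hr : 0 < r)
    (hh : ∀ t : ℝ, 0 < t → ∀ σ ∈ C, SuppLE ρ σ → antiObjective ρ r t σ ≤ h)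
    {ε : ℝ} (hε : 0 < ε) :
    ∃ τ ∈ stdSimplex ℝ X, ∃ σ ∈ C, SuppLE τ ρ ∧ SuppLE ρ σ ∧
      (∀ σ' ∈ C, ∑ x, σ' x * (τ x / σ x) ≤ 1) ∧
      klSum τ ρ + max (r - klSum τ σ) 0 ≤ h + ε := by
  -- `D_{1 + t}(ρ‖σ₀) ≤ M` for all `t`, so only the `σ` with `D(ρ‖σ) ≤ M` compete for the maximum;
  -- these satisfy `c ≤ σ`.
  set M : ℝ := ∑ x, |Real.log (ρ x / σ₀ x)|
  set c : X → ℝ := fun x => ρ x * Real.exp (-((M + 1) / ρ x))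
  have hMx : ∀ x, Real.log (ρ x / σ₀ x) ≤ M := fun x => (le_abs_self _).trans
    (Finset.single_le_sum (f := fun x => |Real.log (ρ x / σ₀ x)|)
      (fun _ _ => abs_nonneg _) (Finset.mem_univ x))
  have hc0 : ∀ x, 0 < ρ x → 0 < c x := fun x hx => mul_pos hx (Real.exp_pos _)
  have hlog₀ : ∀ t : ℝ, 0 < t → Real.log (tiltSum ρ σ₀ t) ≤ t * M := fun t ht => by
    rw [Real.log_le_iff_le_exp (tiltSum_pos hρ _ _)]
    calc tiltSum ρ σ₀ t ≤ ∑ x, ρ x * Real.exp (t * M) := by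
          refine Finset.sum_le_sum fun x _ => mul_le_mul_of_nonneg_left ?_ (hρ.1 x)
          exact Real.exp_le_exp.2 (mul_le_mul_of_nonneg_left (hMx x) ht.le)
      _ = _ := by rw [← Finset.sum_mul, hρ.2, one_mul]
  set L : ℝ := ∑ x, |Real.log (c x)|
  have hL0 : 0 ≤ L := Finset.sum_nonneg fun _ _ => abs_nonneg _
  -- `L` bounds `D(τ‖σ)`, which controls the error `δ (D(τ‖σ) - r)` at the endpoint `t = δ`; the
  -- error at `t = A` is at most `r / (1 + A)`.
  obtain ⟨δ, hδ, hδL, hδ1⟩ : ∃ δ : ℝ, 0 < δ ∧ δ * L ≤ ε ∧ δ ≤ 1 := by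
    refine ⟨min 1 (ε / (L + 1)), by positivity, ?_, min_le_left _ _⟩
    have : min 1 (ε / (L + 1)) ≤ ε / (L + 1) := min_le_right _ _
    calc _ ≤ ε / (L + 1) * (L + 1) := by
          refine mul_le_mul this (by linarith) hL0 (by positivity)
      _ = ε := by field_simp
  set A : ℝ := 1 + r / ε with hA
  have hA1 : 1 < A := by
    have : 0 < r / ε := by positivity
    linarith
  have hAr : r / (1 + A) ≤ ε := by
    rw [div_le_iff₀ (by linarith), hA]
    have : ε * (1 + (1 + r / ε)) = 2 * ε + r := by field_simp; ring
    linarith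
  set K : Set (X → ℝ) := C ∩ {σ | ∀ x, c x ≤ σ x}
  have hKcl : IsClosed {σ : X → ℝ | ∀ x, c x ≤ σ x} := by
    simp only [Set.ofPred_forall]
    exact isClosed_iInter fun x => isClosed_le continuous_const (continuous_apply x)
  have hKsupp : ∀ σ ∈ K, SuppLE ρ σ := fun σ hσ x hx => by
    by_contra h0
    have := hc0 x ((hρ.1 x).lt_of_ne' h0)
    have := hσ.2 x
    linarith
  have hKmem : ∀ σ ∈ C, SuppLE ρ σ → klSum ρ σ ≤ M → σ ∈ K := fun σ hσ hs hk =>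
    ⟨hσ, le_of_klSum_le hρ (hC hσ) hs hk⟩
  have hσ₀K : σ₀ ∈ K := by
    refine hKmem _ hσ₀ hsupp₀ ?_
    calc klSum ρ σ₀ ≤ ∑ x, ρ x * M :=
          Finset.sum_le_sum fun x _ => mul_le_mul_of_nonneg_left (hMx x) (hρ.1 x)
      _ = M := by rw [← Finset.sum_mul, hρ.2, one_mul]
  obtain ⟨⟨t, σ⟩, ⟨ht, hσ⟩, hmax⟩ := (isCompact_Icc.prod (hcomp.inter_right hKcl) :
      IsCompact (Set.Icc δ A ×ˢ K)).exists_isMaxOn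
    ⟨(δ, σ₀), ⟨⟨le_rfl, by linarith⟩, hσ₀K⟩⟩
    (continuousOn_antiObjective hρ r (s := Set.Icc δ A ×ˢ K) fun p hp =>
      ⟨hδ.trans_le hp.1.1, hKsupp _ hp.2⟩)
  replace ht : t ∈ Set.Icc δ A := ht
  have ht0 : 0 < t := hδ.trans_le ht.1
  have hs := hKsupp σ hσ
  have hmaxt : ∀ u ∈ Set.Icc δ A, antiObjective ρ r u σ ≤ antiObjective ρ r t σ :=
    fun u hu => hmax (a := (u, σ)) ⟨hu, hσ⟩
  have hmaxσ : ∀ σ' ∈ C, SuppLE ρ σ' → tiltSum ρ σ t ≤ tiltSum ρ σ' t := by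
    have key : ∀ σ' ∈ K, Real.log (tiltSum ρ σ t) ≤ Real.log (tiltSum ρ σ' t) := fun σ' hσ' => by
      have h1 : antiObjective ρ r t σ' ≤ antiObjective ρ r t σ :=
        hmax (a := (t, σ')) ⟨ht, hσ'⟩
      unfold antiObjective at h1
      have := (div_le_div_iff_of_pos_right (show 0 < 1 + t by linarith)).1 h1
      linarith
    intro σ' hσ' hs'
    rw [← Real.log_le_log_iff (tiltSum_pos hρ _ _) (tiltSum_pos hρ _ _)]
    by_cases hk : klSum ρ σ' ≤ M
    · exact key σ' (hKmem σ' hσ' hs' hk)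
    · calc _ ≤ _ := key σ₀ hσ₀K
        _ ≤ t * M := hlog₀ t ht0
        _ ≤ t * klSum ρ σ' := mul_le_mul_of_nonneg_left (not_le.1 hk).le ht0.le
        _ ≤ _ := mul_klSum_le_log_tiltSum hρ σ' t
  have hτ := tilt_mem hρ σ t
  have hτρ : SuppLE (tilt ρ σ t) ρ := fun x hx => by simp [tilt, hx]
  have hτσ : SuppLE (tilt ρ σ t) σ := fun x hx => hτρ x (hs x hx)
  refine ⟨tilt ρ σ t, hτ, σ, hσ.1, hτρ, hs, ?_, ?_⟩
  · refine fun σ' hσ' => sum_mul_tilt_div_le_one hρ hs ht0 fun l hl0 hl1 => ?_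
    refine hmaxσ _ (hconv hσ.1 hσ' (by linarith) hl0.le (by ring)) fun x hx => ?_
    have h1 := (hC hσ.1).1 x
    have h2 := (hC hσ').1 x
    have h3 : (1 - l) * σ x = 0 := by
      have h4 := mul_nonneg (sub_nonneg.2 hl1.le) h1
      have h5 := mul_nonneg hl0.le h2
      linarith
    exact hs x ((mul_eq_zero.1 h3).resolve_left (by linarith))
  set d := klSum (tilt ρ σ t) σ with hd
  have hd0 : 0 ≤ d := klSum_nonneg hτ (hC hσ.1) hτσ
  have hderiv := hasDerivAt_antiObjective hρ hs r ht0
  rw [← hd] at hderiv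
  have hsq : 0 < (1 + t) ^ 2 := by positivity
  -- The first-order condition in `t`, one-sided at the endpoints of `[δ, A]`.
  have hdr : t < A → r ≤ d := fun htA => by
    have h1 := nonneg_of_hasDerivAt_of_le_right hderiv.neg (by
      filter_upwards [Ioo_mem_nhdsGT htA] with u hu
      simpa using hmaxt u ⟨ht.1.trans hu.1.le, hu.2.le⟩)
    rw [neg_nonneg, div_le_iff₀ hsq] at h1
    linarith
  have hrd : δ < t → d ≤ r := fun htδ => by
    have h1 := nonpos_of_hasDerivAt_of_le_left hderiv.neg (by
      filter_upwards [Ioo_mem_nhdsLT htδ] with u hu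
      simpa using hmaxt u ⟨hu.1.le, hu.2.le.trans ht.2⟩)
    rw [neg_nonpos, le_div_iff₀ hsq] at h1
    linarith
  have hφ := hh t ht0 σ hσ.1 hs
  -- `D(τ‖ρ) + s (r - D(τ‖σ))` is the value of the objective, where `s = t / (1 + t)`.
  have hid : klSum (tilt ρ σ t) ρ = antiObjective ρ r t σ + t / (1 + t) * (d - r) := by
    rw [hd, klSum_tilt_left hρ, klSum_tilt_right hρ hs, antiObjective]
    field_simp
    ring
  rcases le_total r d with hle | hle
  · rw [max_eq_right (by linarith), add_zero, hid]
    suffices h1 : t / (1 + t) * (d - r) ≤ ε by linarith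
    rcases ht.1.eq_or_lt with h1 | h1
    · have hdL : d ≤ L := by
        have h2 : d ≤ ∑ x, tilt ρ σ t x * L := by
          refine Finset.sum_le_sum fun x _ => ?_
          rcases (hτ.1 x).eq_or_lt with h3 | h3
          · simp [← h3]
          refine mul_le_mul_of_nonneg_left ?_ h3.le
          have hρx : 0 < ρ x := (hρ.1 x).lt_of_ne' fun h4 => h3.ne' (hτρ x h4)
          have hcx := hc0 x hρx
          have hσx : 0 < σ x := hcx.trans_le (hσ.2 x)
          have hτ1 : tilt ρ σ t x ≤ 1 := by
            rw [← hτ.2]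
            exact Finset.single_le_sum (fun y _ => hτ.1 y) (Finset.mem_univ x)
          calc Real.log (tilt ρ σ t x / σ x) ≤ Real.log (1 / c x) := by
                refine Real.log_le_log (div_pos h3 hσx) ?_
                exact div_le_div₀ zero_le_one hτ1 hcx (hσ.2 x)
            _ = -Real.log (c x) := by rw [one_div, Real.log_inv]
            _ ≤ |Real.log (c x)| := neg_le_abs _
            _ ≤ L := Finset.single_le_sum (f := fun x => |Real.log (c x)|)
                (fun _ _ => abs_nonneg _) (Finset.mem_univ x)
        rwa [← Finset.sum_mul, hτ.2, one_mul] at h2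
      have h4 : t / (1 + t) ≤ δ := by
        rw [← h1, div_le_iff₀ (by linarith)]
        nlinarith
      calc t / (1 + t) * (d - r) ≤ δ * L :=
            mul_le_mul h4 (by linarith) (by linarith) hδ.le
        _ ≤ ε := hδL
    · have := hrd h1
      rw [le_antisymm hle this]
      simpa using hε.le
  · rw [max_eq_left (by linarith), hid]
    have h1 : antiObjective ρ r t σ + t / (1 + t) * (d - r) + (r - d) =
        antiObjective ρ r t σ + (r - d) / (1 + t) := by
      field_simp
      ring
    rw [h1]
    suffices h1 : (r - d) / (1 + t) ≤ ε by linarith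
    rcases ht.2.eq_or_lt with h2 | h2
    · rw [h2]
      exact (div_le_div_of_nonneg_right (by linarith) (by linarith)).trans hAr
    · rw [le_antisymm (hdr h2) hle]
      simpa using hε.le

end Tilting

end CompositeTesting

namespace CompositeTesting

section Exponents

/-! ### Rates of probabilities -/

lemma rate_anti (n : ℕ) {p q : ℝ≥0∞} (h : p ≤ q) : rate n q ≤ rate n p :=
  mul_le_mul_of_nonneg_left (EReal.neg_le_neg_iff.2 (ENNReal.log_le_log h))
    (EReal.coe_nonneg.2 (by positivity))

lemma rate_ofReal_of_pos (n : ℕ) {p : ℝ} (hp : 0 < p) :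
    rate n (ENNReal.ofReal p) = (((n : ℝ)⁻¹ * -Real.log p : ℝ) : EReal) := by
  rw [rate, ENNReal.log_ofReal, if_neg (not_le.2 hp)]
  norm_cast

lemma rate_ofReal_of_nonpos {n : ℕ} (hn : 0 < n) {p : ℝ} (hp : p ≤ 0) :
    rate n (ENNReal.ofReal p) = ⊤ := by
  rw [rate, ENNReal.log_ofReal, if_pos hp, EReal.neg_bot, EReal.coe_mul_top_of_pos]
  positivity

lemma le_rate_iff {n : ℕ} (hn : 0 < n) {p y : ℝ} :
    (y : EReal) ≤ rate n (ENNReal.ofReal p) ↔ p ≤ Real.exp (-(n * y)) := by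
  rcases le_or_gt p 0 with hp | hp
  · rw [rate_ofReal_of_nonpos hn hp]
    exact iff_of_true le_top (hp.trans (Real.exp_pos _).le)
  · rw [rate_ofReal_of_pos n hp, EReal.coe_le_coe_iff, ← Real.log_le_iff_le_exp hp,
      inv_mul_eq_div, le_div_iff₀ (by positivity), mul_comm y, le_neg]

lemma rate_le_iff {n : ℕ} (hn : 0 < n) {p y : ℝ} :
    rate n (ENNReal.ofReal p) ≤ (y : EReal) ↔ Real.exp (-(n * y)) ≤ p := by
  rcases le_or_gt p 0 with hp | hp
  · rw [rate_ofReal_of_nonpos hn hp]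
    exact iff_of_false (not_le.2 (EReal.coe_lt_top y)) (not_le.2 (hp.trans_lt (Real.exp_pos _)))
  · rw [rate_ofReal_of_pos n hp, EReal.coe_le_coe_iff, ← Real.le_log_iff_exp_le hp,
      inv_mul_eq_div, div_le_iff₀ (by positivity), mul_comm y, neg_le]

variable {X : Type*}

lemma tensorPow_nonneg {τ : X → ℝ} (hτ : ∀ x, 0 ≤ τ x) (n : ℕ) (x : Fin n → X) :
    0 ≤ tensorPow τ n x :=
  Finset.prod_nonneg fun i _ => hτ (x i)

lemma iidSet_subset_avSet (C : Set (X → ℝ)) (n : ℕ) : iidSet C n ⊆ avSet C n := by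
  rintro _ ⟨σ, hσ, rfl⟩
  exact ⟨fun _ => σ, fun _ => hσ, rfl⟩

lemma avSet_subset_advSet (C : Set (X → ℝ)) (n : ℕ) : avSet C n ⊆ advSet C n := by
  rintro _ ⟨σ, hσ, rfl⟩
  exact ⟨fun i _ => σ i, fun i _ => hσ i, rfl⟩

lemma advSet_mono {S C : Set (X → ℝ)} (h : S ⊆ C) (n : ℕ) : advSet S n ⊆ advSet C n := by
  rintro _ ⟨κ, hκ, rfl⟩
  exact ⟨κ, fun i y => h (hκ i y), rfl⟩

lemma subset_cco (S : Set (X → ℝ)) : S ⊆ cco S :=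
  (subset_convexHull ℝ S).trans subset_closure

variable [Fintype X]

lemma sum_tensorPow (τ : X → ℝ) (n : ℕ) : ∑ x, tensorPow τ n x = (∑ x, τ x) ^ n :=
  (Fintype.sum_pow τ n).symm

lemma typeII_iidSet_singleton (σ : X → ℝ) (n : ℕ) (T : (Fin n → X) → ℝ) :
    typeII (iidSet {σ} n) T = ENNReal.ofReal (∑ x, tensorPow σ n x * T x) := by
  simp [typeII, iidSet]

lemma one_sub_typeI_iidSet_singleton {ρ : X → ℝ} (hρ : ρ ∈ stdSimplex ℝ X) (n : ℕ)
    {T : (Fin n → X) → ℝ} (hT : ∀ x, T x ∈ Set.Icc (0 : ℝ) 1) :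
    1 - typeI (iidSet {ρ} n) T = ENNReal.ofReal (∑ x, tensorPow ρ n x * T x) := by
  have h1 : typeI (iidSet {ρ} n) T = ENNReal.ofReal (∑ x, tensorPow ρ n x * (1 - T x)) := by
    simp [typeI, iidSet]
  have h2 : 0 ≤ ∑ x, tensorPow ρ n x * (1 - T x) := Finset.sum_nonneg fun x _ =>
    mul_nonneg (tensorPow_nonneg hρ.1 n x) (sub_nonneg.2 (hT x).2)
  rw [h1, ← ENNReal.ofReal_one, ← ENNReal.ofReal_sub _ h2]
  congr 1
  simp only [mul_sub, mul_one, Finset.sum_sub_distrib, sum_tensorPow, hρ.2, one_pow]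
  ring

lemma typeII_mono {Y : Type*} [Fintype Y] {S S' : Set (Y → ℝ)} (h : S ⊆ S') (T : Y → ℝ) :
    typeII S T ≤ typeII S' T :=
  biSup_mono h

/-- The strong converse exponent grows with the worst-case type II errors of tests. -/
lemma sc_mono_of_typeII_le (r : ℝ) (R : ∀ n : ℕ, Set ((Fin n → X) → ℝ))
    {S S' : ∀ n : ℕ, Set ((Fin n → X) → ℝ)}
    (h : ∀ n (T : (Fin n → X) → ℝ), typeII (S n) T ≤ typeII (S' n) T) :
    sc r R S ≤ sc r R S' := by
  refine le_iInf fun T => le_iInf fun hT => le_iInf fun hr =>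
    iInf_le_of_le T (iInf_le_of_le hT (iInf_le_of_le (hr.trans ?_) le_rfl))
  exact liminf_le_liminf (Eventually.of_forall fun n => rate_anti n (h n (T n)))

lemma sc_mono (r : ℝ) (R : ∀ n : ℕ, Set ((Fin n → X) → ℝ))
    {S S' : ∀ n : ℕ, Set ((Fin n → X) → ℝ)} (h : ∀ n, S n ⊆ S' n) : sc r R S ≤ sc r R S' :=
  sc_mono_of_typeII_le r R fun n T => typeII_mono (h n) T

lemma iSup_sc_le_scRelaxedAlt (r : ℝ) (R : ∀ n : ℕ, Set ((Fin n → X) → ℝ)) (C : Set (X → ℝ)) :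
    (⨆ σ ∈ C, sc r R (iidSet {σ})) ≤
      scRelaxedAlt r R (fun (σ : C) (n : ℕ) => tensorPow (σ : X → ℝ) n) := by
  refine iSup₂_le fun σ hσ => le_iInf fun T => le_iInf fun hT => le_iInf fun hr =>
    iInf_le_of_le T (iInf_le_of_le hT (iInf_le_of_le (hr.trans ?_) le_rfl))
  refine (iInf_le _ (⟨σ, hσ⟩ : C)).trans (le_of_eq ?_)
  simp [typeII, iidSet]

lemma scRelaxedAlt_le_sc (r : ℝ) (R : ∀ n : ℕ, Set ((Fin n → X) → ℝ)) (C : Set (X → ℝ)) :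
    scRelaxedAlt r R (fun (σ : C) (n : ℕ) => tensorPow (σ : X → ℝ) n) ≤ sc r R (iidSet C) := by
  refine le_iInf fun T => le_iInf fun hT => le_iInf fun hr =>
    iInf_le_of_le T (iInf_le_of_le hT (iInf_le_of_le (hr.trans ?_) le_rfl))
  refine le_iInf fun σ => liminf_le_liminf (Eventually.of_forall fun n => rate_anti n ?_)
  refine typeII_mono ?_ _
  rintro _ rfl
  exact ⟨σ, σ.2, rfl⟩

/-! ### Arbitrarily varying hypotheses and closed convex hulls -/

/-- A product state depends affinely and continuously on each factor, so passing to the closed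
convex hull does not increase the worst-case type II error. The factors are moved from `S` to
`cco S` one at a time. -/
lemma typeII_avSet_cco_le (S : Set (X → ℝ)) (n : ℕ) (T : (Fin n → X) → ℝ) :
    typeII (avSet (cco S) n) T ≤ typeII (avSet S n) T := by
  classical
  set B := typeII (avSet S n) T with hB
  rcases eq_or_ne B ⊤ with hBt | hBt
  · rw [hBt]; exact le_top
  suffices key : ∀ s : Finset (Fin n), ∀ σ : Fin n → X → ℝ, (∀ i ∈ s, σ i ∈ cco S) →
      (∀ i, i ∉ s → σ i ∈ S) → ∑ x : Fin n → X, (∏ i, σ i (x i)) * T x ≤ B.toReal by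
    refine iSup₂_le ?_
    rintro _ ⟨σ, hσ, rfl⟩
    exact (ENNReal.ofReal_le_iff_le_toReal hBt).2
      (key Finset.univ σ (fun i _ => hσ i) (fun i hi => absurd (Finset.mem_univ i) hi))
  intro s
  induction s using Finset.induction_on with
  | empty =>
    intro σ _ hσ
    rw [← ENNReal.ofReal_le_iff_le_toReal hBt, hB]
    exact le_iSup₂_of_le (fun x => ∏ i, σ i (x i)) ⟨σ, fun i => hσ i (Finset.notMem_empty i), rfl⟩
      le_rfl
  | insert i s hi ih =>
    intro σ hσ hσS
    set f : (X → ℝ) → ℝ := fun p =>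
      ∑ x : Fin n → X, (p (x i) * ∏ j ∈ Finset.univ.erase i, σ j (x j)) * T x with hf
    have hfu : ∀ p : X → ℝ,
        f p = ∑ x : Fin n → X, (∏ j, Function.update σ i p j (x j)) * T x := fun p => by
      refine Finset.sum_congr rfl fun x _ => ?_
      rw [← Finset.mul_prod_erase _ _ (Finset.mem_univ i), Function.update_self]
      congr 2
      refine Finset.prod_congr rfl fun j hj => ?_
      rw [Function.update_of_ne (Finset.ne_of_mem_erase hj)]
    have hcont : Continuous f := by fun_prop
    have hconv : Convex ℝ {p | f p ≤ B.toReal} := by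
      refine convex_halfSpace_le ⟨fun p q => ?_, fun c p => ?_⟩ _
      · simp only [hf, Pi.add_apply, ← Finset.sum_add_distrib]
        exact Finset.sum_congr rfl fun x _ => by ring
      · simp only [hf, Pi.smul_apply, smul_eq_mul, Finset.mul_sum]
        exact Finset.sum_congr rfl fun x _ => by ring
    have hS : S ⊆ {p | f p ≤ B.toReal} := fun p hp => by
      change f p ≤ _
      rw [hfu]
      refine ih _ (fun j hj => ?_) fun j hj => ?_
      · rw [Function.update_of_ne (ne_of_mem_of_not_mem hj hi)]
        exact hσ j (Finset.mem_insert_of_mem hj)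
      · rcases eq_or_ne j i with rfl | hji
        · rwa [Function.update_self]
        · rw [Function.update_of_ne hji]
          exact hσS j fun h => (Finset.mem_insert.1 h).elim hji hj
    have h1 : cco S ⊆ {p | f p ≤ B.toReal} :=
      closure_minimal (convexHull_min hS hconv) (isClosed_le hcont continuous_const)
    have h2 : f (σ i) ≤ B.toReal := h1 (hσ i (Finset.mem_insert_self i s))
    rwa [hfu, Function.update_eq_self] at h2

/-! ### Achievability against an adversary -/

lemma sum_fin_succ_snoc {n : ℕ} (f : (Fin (n + 1) → X) → ℝ) :
    ∑ x, f x = ∑ y : Fin n → X, ∑ a : X, f (Fin.snoc (α := fun _ => X) y a) := by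
  rw [← (Fin.snocEquiv (fun _ => X)).sum_comp, Fintype.sum_prod_type_right]
  rfl

/-- If `w` has mean at most `1` under every member of `C`, then the product of the `w (x i)` is a
supermartingale under every adversarial strategy. -/
lemma sum_advSet_mul_prod_le_one {C : Set (X → ℝ)} (hC : C ⊆ stdSimplex ℝ X) {w : X → ℝ}
    (hw : ∀ x, 0 ≤ w x) (hCw : ∀ σ ∈ C, ∑ x, σ x * w x ≤ 1) (n : ℕ) :
    ∀ p ∈ advSet C n, ∑ x : Fin n → X, p x * ∏ i, w (x i) ≤ 1 := by
  induction n with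
  | zero =>
    rintro _ ⟨κ, hκ, rfl⟩
    simp
  | succ n ih =>
    rintro _ ⟨κ, hκ, rfl⟩
    have h1 := ih _ ⟨fun i => κ i.castSucc, fun i y => hκ i.castSucc y, rfl⟩
    rw [sum_fin_succ_snoc]
    refine (Finset.sum_le_sum fun y _ => ?_).trans h1
    have h2 : ∀ a : X, (∏ i : Fin (n + 1), κ i (fun j =>
        (Fin.snoc (α := fun _ => X) y a : Fin (n + 1) → X) (Fin.castLE i.isLt.le j))
          ((Fin.snoc (α := fun _ => X) y a : Fin (n + 1) → X) i)) *
        ∏ i : Fin (n + 1), w ((Fin.snoc (α := fun _ => X) y a : Fin (n + 1) → X) i) =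
        ((∏ i : Fin n, κ i.castSucc (fun j => y (Fin.castLE i.isLt.le j)) (y i)) *
          ∏ i, w (y i)) * (κ (Fin.last n) y a * w a) := fun a => by
      rw [Fin.prod_univ_castSucc, Fin.prod_univ_castSucc]
      simp only [Fin.snoc_castSucc, Fin.snoc_last]
      have h3 : ∀ i : Fin n, (fun j : Fin (i.castSucc : ℕ) =>
          (Fin.snoc (α := fun _ => X) y a : Fin (n + 1) → X)
            (Fin.castLE i.castSucc.isLt.le j)) = fun j => y (Fin.castLE i.isLt.le j) := fun i => by
        funext j
        exact Fin.snoc_castSucc (α := fun _ => X) a y (Fin.castLE i.isLt.le j)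
      have h4 : (fun j : Fin (Fin.last n : ℕ) =>
          (Fin.snoc (α := fun _ => X) y a : Fin (n + 1) → X)
            (Fin.castLE (Fin.last n).isLt.le j)) = y := by
        funext j
        exact Fin.snoc_castSucc (α := fun _ => X) a y j
      simp only [h3, h4]
      exact mul_mul_mul_comm _ _ _ _
    simp only [h2]
    rw [← Finset.mul_sum]
    refine mul_le_of_le_one_right (mul_nonneg ?_ (Finset.prod_nonneg fun i _ => hw _))
      (hCw _ (hκ _ _))
    exact Finset.prod_nonneg fun i _ => (hC (hκ _ _)).1 _

/-- The variance of a sum of i.i.d. centred variables. -/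
lemma sum_tensorPow_mul_sum_sq {τ : X → ℝ} (hτ : ∑ x, τ x = 1) {g : X → ℝ}
    (hg : ∑ x, τ x * g x = 0) (n : ℕ) :
    ∑ x : Fin n → X, tensorPow τ n x * (∑ i, g (x i)) ^ 2 = n * ∑ x, τ x * g x ^ 2 := by
  induction n with
  | zero => simp
  | succ n ih =>
    have h0 := sum_tensorPow τ n
    rw [sum_fin_succ_snoc]
    simp only [tensorPow, Fin.prod_univ_castSucc, Fin.sum_univ_castSucc, Fin.snoc_castSucc,
      Fin.snoc_last] at ih h0 ⊢
    have h1 : ∀ y : Fin n → X, ∑ a, (∏ i, τ (y i)) * τ a * (∑ i, g (y i) + g a) ^ 2 =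
        (∏ i, τ (y i)) * (∑ i, g (y i)) ^ 2 + (∏ i, τ (y i)) * ∑ a, τ a * g a ^ 2 := fun y => by
      calc _ = (∏ i, τ (y i)) * (∑ i, g (y i)) ^ 2 * ∑ a, τ a +
            2 * (∏ i, τ (y i)) * (∑ i, g (y i)) * (∑ a, τ a * g a) +
            (∏ i, τ (y i)) * ∑ a, τ a * g a ^ 2 := by
            simp only [Finset.mul_sum (s := (Finset.univ : Finset X)), ← Finset.sum_add_distrib]
            exact Finset.sum_congr rfl fun a _ => by ring
        _ = _ := by rw [hτ, hg]; ring
    simp only [h1, Finset.sum_add_distrib, ih, ← Finset.sum_mul, h0, hτ]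
    push_cast
    ring

/-- Weak law of large numbers for two functions at once: eventually the set on which both
empirical means are `δ`-close to the true means has probability at least one half. -/
lemma eventually_half_le_sum_typical {τ : X → ℝ} (hτ : τ ∈ stdSimplex ℝ X) (a b : X → ℝ)
    {δ : ℝ} (hδ : 0 < δ) (E : ∀ n : ℕ, Set (Fin n → X))
    (hE : ∀ n (x : Fin n → X), (∀ i, 0 < τ (x i)) →
      |∑ i, (a (x i) - ∑ y, τ y * a y)| ≤ n * δ → |∑ i, (b (x i) - ∑ y, τ y * b y)| ≤ n * δ →
      x ∈ E n) :
    ∀ᶠ n : ℕ in atTop, 1 / 2 ≤ ∑ x, tensorPow τ n x * (E n).indicator 1 x := by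
  set g : X → ℝ := fun x => a x - ∑ y, τ y * a y with hg
  set k : X → ℝ := fun x => b x - ∑ y, τ y * b y with hk
  have hg0 : ∑ x, τ x * g x = 0 := by
    simp only [hg, mul_sub, Finset.sum_sub_distrib, ← Finset.sum_mul, hτ.2]; ring
  have hk0 : ∑ x, τ x * k x = 0 := by
    simp only [hk, mul_sub, Finset.sum_sub_distrib, ← Finset.sum_mul, hτ.2]; ring
  set V : ℝ := ∑ x, τ x * g x ^ 2 + ∑ x, τ x * k x ^ 2 with hV
  have hlarge : ∀ᶠ n : ℕ in atTop, 2 * V / δ ^ 2 ≤ n :=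
    tendsto_natCast_atTop_atTop.eventually_ge_atTop _
  filter_upwards [hlarge, eventually_gt_atTop 0] with n hn hn0
  have hn0' : (0 : ℝ) < n := by exact_mod_cast hn0
  have hpt : ∀ x : Fin n → X, tensorPow τ n x * (1 - (E n).indicator 1 x) ≤
      tensorPow τ n x * (((∑ i, g (x i)) ^ 2 + (∑ i, k (x i)) ^ 2) / (n * δ) ^ 2) := fun x => by
    rcases (tensorPow_nonneg hτ.1 n x).eq_or_lt with h0 | h0
    · simp [← h0]
    have hpos : ∀ i, 0 < τ (x i) := fun i => (hτ.1 _).lt_of_ne' fun h' =>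
      h0.ne' (Finset.prod_eq_zero (Finset.mem_univ i) h')
    refine mul_le_mul_of_nonneg_left ?_ h0.le
    by_cases hx : x ∈ E n
    · rw [Set.indicator_of_mem hx, Pi.one_apply, sub_self]
      positivity
    · rw [Set.indicator_of_notMem hx, sub_zero, le_div_iff₀ (by positivity), one_mul]
      have hnd : 0 ≤ n * δ := by positivity
      by_cases h1 : |∑ i, g (x i)| ≤ n * δ
      · have h2 : n * δ < |∑ i, k (x i)| := not_le.1 fun h2 => hx (hE n x hpos h1 h2)
        have h3 := pow_le_pow_left₀ hnd h2.le 2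
        rw [sq_abs] at h3
        nlinarith [sq_nonneg (∑ i, g (x i))]
      · have h3 := pow_le_pow_left₀ hnd (not_le.1 h1).le 2
        rw [sq_abs] at h3
        nlinarith [sq_nonneg (∑ i, k (x i))]
  have h1 := Finset.sum_le_sum fun x (_ : x ∈ Finset.univ) => hpt x
  simp only [mul_sub, mul_one, Finset.sum_sub_distrib, sum_tensorPow, hτ.2, one_pow] at h1
  have h2 : ∑ x : Fin n → X, tensorPow τ n x *
      (((∑ i, g (x i)) ^ 2 + (∑ i, k (x i)) ^ 2) / (n * δ) ^ 2) = V / (n * δ ^ 2) := by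
    simp only [mul_div_assoc', mul_add, ← Finset.sum_div, Finset.sum_add_distrib,
      sum_tensorPow_mul_sum_sq hτ.2 hg0, sum_tensorPow_mul_sum_sq hτ.2 hk0]
    rw [← mul_add, ← hV]
    field_simp
  rw [h2] at h1
  have h3 : V / (n * δ ^ 2) ≤ 1 / 2 := by
    rw [div_le_iff₀ (by positivity)] at hn ⊢
    linarith
  linarith

/-- A state `τ` with a `σ` such that `τ / σ` has mean at most `1` under every member of `C` yields
tests achieving the exponent `D(τ‖ρ) + (r - D(τ‖σ))⁺` against the adversary: accept, with a
suitable constant probability, the sequences whose likelihood ratios `τ / σ` and `τ / ρ` are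
typical for `τ`. -/
theorem sc_advSet_le {ρ τ σ : X → ℝ} (hρ : ρ ∈ stdSimplex ℝ X) (hτ : τ ∈ stdSimplex ℝ X)
    {C : Set (X → ℝ)} (hC : C ⊆ stdSimplex ℝ X) (hσ : σ ∈ C)
    (hτρ : SuppLE τ ρ) (hρσ : SuppLE ρ σ)
    (hCτ : ∀ σ' ∈ C, ∑ x, σ' x * (τ x / σ x) ≤ 1) (r : ℝ) {ε : ℝ} (hε : 0 < ε) :
    sc r (iidSet {ρ}) (advSet C) ≤
      ((klSum τ ρ + max (r - klSum τ σ) 0 + ε : ℝ) : EReal) := by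
  set m := max (r - klSum τ σ) 0 with hm
  have hm0 : 0 ≤ m := le_max_right _ _
  have hmr : r - klSum τ σ ≤ m := le_max_left _ _
  set δ := ε / 3 with hδ
  have hδ0 : 0 < δ := by positivity
  set a : X → ℝ := fun x => Real.log (τ x / σ x) with ha
  set b : X → ℝ := fun x => Real.log (τ x / ρ x) with hb
  set E : ∀ n : ℕ, Set (Fin n → X) := fun n =>
    {x | (∀ i, 0 < τ (x i)) ∧ n * (klSum τ σ - δ) ≤ ∑ i, a (x i) ∧
      ∑ i, b (x i) ≤ n * (klSum τ ρ + δ)} with hE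
  set T : ∀ n : ℕ, (Fin n → X) → ℝ := fun n x =>
    Real.exp (-(n * (m + δ))) * (E n).indicator 1 x with hT
  have hTtest : IsTestSeq T := fun n x => by
    have h1 : Real.exp (-(n * (m + δ))) ≤ 1 := Real.exp_le_one_iff.2 (by
      rw [neg_nonpos]; positivity)
    have h2 := Real.exp_pos (-(n * (m + δ)))
    by_cases hx : x ∈ E n
    · simp only [hT, Set.indicator_of_mem hx, Pi.one_apply, mul_one]
      exact ⟨h2.le, h1⟩
    · simp [hT, Set.indicator_of_notMem hx]
  refine iInf_le_of_le T (iInf_le_of_le hTtest (iInf_le_of_le ?_ ?_))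
  · refine le_liminf_of_le (by isBoundedDefault) ?_
    filter_upwards [eventually_gt_atTop 0] with n hn
    suffices h : typeII (advSet C n) (T n) ≤ ENNReal.ofReal (Real.exp (-(n * r))) from
      ((le_rate_iff hn).2 le_rfl).trans (rate_anti n h)
    refine iSup₂_le fun p hp => ENNReal.ofReal_le_ofReal ?_
    have hw : ∀ x, 0 ≤ τ x / σ x := fun x => div_nonneg (hτ.1 x) ((hC hσ).1 x)
    have hp0 : ∀ x, 0 ≤ p x := by
      obtain ⟨κ, hκ, rfl⟩ := hp
      exact fun x => Finset.prod_nonneg fun i _ => (hC (hκ _ _)).1 _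
    -- Markov's inequality, pointwise.
    have h1 : ∀ x : Fin n → X, (E n).indicator 1 x ≤
        Real.exp (-(n * (klSum τ σ - δ))) * ∏ i, (τ (x i) / σ (x i)) := fun x => by
      by_cases hx : x ∈ E n
      · rw [Set.indicator_of_mem hx, Pi.one_apply]
        have h2 : ∏ i, (τ (x i) / σ (x i)) = Real.exp (∑ i, a (x i)) := by
          rw [Real.exp_sum]
          refine Finset.prod_congr rfl fun i _ => (Real.exp_log (div_pos (hx.1 i) ?_)).symm
          exact ((hC hσ).1 _).lt_of_ne' fun h' => (hx.1 i).ne' (hτρ _ (hρσ _ h'))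
        rw [h2, ← Real.exp_add, Real.one_le_exp_iff]
        linarith [hx.2.1]
      · rw [Set.indicator_of_notMem hx]
        exact mul_nonneg (Real.exp_pos _).le (Finset.prod_nonneg fun i _ => hw _)
    calc ∑ x, p x * T n x ≤ ∑ x, p x * (Real.exp (-(n * (m + δ))) *
          (Real.exp (-(n * (klSum τ σ - δ))) * ∏ i, (τ (x i) / σ (x i)))) :=
          Finset.sum_le_sum fun x _ => mul_le_mul_of_nonneg_left
            (mul_le_mul_of_nonneg_left (h1 x) (Real.exp_pos _).le) (hp0 x)
      _ = Real.exp (-(n * (m + δ)) + -(n * (klSum τ σ - δ))) *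
          ∑ x, p x * ∏ i, (τ (x i) / σ (x i)) := by
          rw [Finset.mul_sum, Real.exp_add]
          exact Finset.sum_congr rfl fun x _ => by ring
      _ ≤ Real.exp (-(n * (m + δ)) + -(n * (klSum τ σ - δ))) * 1 :=
          mul_le_mul_of_nonneg_left (sum_advSet_mul_prod_le_one hC hw hCτ n p hp)
            (Real.exp_pos _).le
      _ ≤ Real.exp (-(n * r)) := by
          rw [mul_one, Real.exp_le_exp]
          have : (n : ℝ) * r ≤ n * (m + klSum τ σ) :=
            mul_le_mul_of_nonneg_left (by linarith) (Nat.cast_nonneg n)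
          linarith
  · refine limsup_le_of_le (by isBoundedDefault) ?_
    have hhalf : ∀ᶠ n : ℕ in atTop, 1 / 2 ≤ ∑ x, tensorPow τ n x * (E n).indicator 1 x := by
      refine eventually_half_le_sum_typical hτ a b hδ0 E fun n x hx h1 h2 => ⟨hx, ?_, ?_⟩
      · have h3 := (abs_le.1 h1).1
        rw [Finset.sum_sub_distrib] at h3
        simp only [Finset.sum_const, Finset.card_univ, Fintype.card_fin, nsmul_eq_mul] at h3
        change -(n * δ) ≤ _ - n * klSum τ σ at h3
        linarith
      · have h3 := (abs_le.1 h2).2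
        rw [Finset.sum_sub_distrib] at h3
        simp only [Finset.sum_const, Finset.card_univ, Fintype.card_fin, nsmul_eq_mul] at h3
        change _ - n * klSum τ ρ ≤ _ at h3
        linarith
    have hlarge : ∀ᶠ n : ℕ in atTop, Real.log 2 / δ ≤ n :=
      tendsto_natCast_atTop_atTop.eventually_ge_atTop _
    filter_upwards [hhalf, hlarge, eventually_gt_atTop 0] with n h1 h2 hn
    rw [one_sub_typeI_iidSet_singleton hρ n (hTtest n), rate_le_iff hn]
    -- On the typical set `ρ^{⊗ n}` is at least `exp (-n (D(τ‖ρ) + δ)) τ^{⊗ n}`.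
    have h3 : ∀ x : Fin n → X, Real.exp (-(n * (klSum τ ρ + δ))) *
        (tensorPow τ n x * (E n).indicator 1 x) ≤ tensorPow ρ n x * (E n).indicator 1 x :=
        fun x => by
      by_cases hx : x ∈ E n
      · simp only [Set.indicator_of_mem hx, Pi.one_apply, mul_one]
        have h4 : tensorPow τ n x = Real.exp (∑ i, b (x i)) * tensorPow ρ n x := by
          rw [Real.exp_sum, tensorPow, tensorPow, ← Finset.prod_mul_distrib]
          refine Finset.prod_congr rfl fun i _ => ?_
          have h5 : 0 < ρ (x i) := (hρ.1 _).lt_of_ne' fun h' => (hx.1 i).ne' (hτρ _ h')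
          rw [hb, Real.exp_log (div_pos (hx.1 i) h5), div_mul_cancel₀ _ h5.ne']
        rw [h4, ← mul_assoc, ← Real.exp_add]
        refine mul_le_of_le_one_left (tensorPow_nonneg hρ.1 n x) (Real.exp_le_one_iff.2 ?_)
        linarith [hx.2.2]
      · simp [Set.indicator_of_notMem hx]
    have h4 := Finset.sum_le_sum fun x (_ : x ∈ Finset.univ) => h3 x
    rw [← Finset.mul_sum] at h4
    have h5 : Real.exp (-(n * δ)) ≤ 1 / 2 := by
      rw [div_le_iff₀ hδ0] at h2
      rw [one_div, ← Real.exp_log (show (0 : ℝ) < 2⁻¹ by norm_num), Real.exp_le_exp, Real.log_inv]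
      linarith
    calc Real.exp (-(n * (klSum τ ρ + m + ε))) = Real.exp (-(n * (m + δ))) *
          (Real.exp (-(n * (klSum τ ρ + δ))) * Real.exp (-(n * δ))) := by
          rw [← Real.exp_add, ← Real.exp_add, hδ]
          congr 1
          ring
      _ ≤ Real.exp (-(n * (m + δ))) * ∑ x, tensorPow ρ n x * (E n).indicator 1 x := by
          refine mul_le_mul_of_nonneg_left (le_trans ?_ h4) (Real.exp_pos _).le
          exact mul_le_mul_of_nonneg_left (h5.trans h1) (Real.exp_pos _).le
      _ = ∑ x, tensorPow ρ n x * T n x := by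
          rw [Finset.mul_sum]
          exact Finset.sum_congr rfl fun x _ => by simp only [hT]; ring

end Exponents

end CompositeTesting

namespace CompositeTesting

section Converse

variable {X : Type*}

/-! ### The converse for a simple alternative -/

lemma SuppLE.tensorPow {ρ σ : X → ℝ} (h : SuppLE ρ σ) (n : ℕ) :
    SuppLE (tensorPow ρ n) (tensorPow σ n) := fun x hx => by
  obtain ⟨i, hi, h0⟩ := Finset.prod_eq_zero_iff.1 hx
  exact Finset.prod_eq_zero hi (h _ h0)

variable [Fintype X]

/-- Hölder's inequality between the acceptance probabilities of a test under two states. -/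
lemma sum_mul_test_le {Y : Type*} [Fintype Y] {P Q T : Y → ℝ} (hP : ∀ y, 0 ≤ P y)
    (hQ : ∀ y, 0 ≤ Q y) (h : SuppLE P Q) (hT : ∀ y, T y ∈ Set.Icc (0 : ℝ) 1) {a : ℝ}
    (ha : 1 < a) :
    ∑ y, P y * T y ≤
      (∑ y, P y ^ a * Q y ^ (1 - a)) ^ (1 / a) * (∑ y, Q y * T y) ^ ((a - 1) / a) := by
  have ha0 : 0 < a := by linarith
  have ha1 : 0 < a - 1 := by linarith
  set s := (a - 1) / a with hs
  have hs0 : 0 < s := div_pos ha1 ha0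
  have hpq : a.HolderConjugate s⁻¹ := by
    rw [Real.holderConjugate_iff]
    refine ⟨ha, ?_⟩
    rw [inv_inv, hs]
    field_simp
    ring
  have h1 := Real.inner_le_Lp_mul_Lq_of_nonneg Finset.univ
    (f := fun y => P y * Q y ^ (-s)) (g := fun y => (Q y * T y) ^ s) hpq
    (fun y _ => mul_nonneg (hP y) (Real.rpow_nonneg (hQ y) _))
    (fun y _ => Real.rpow_nonneg (mul_nonneg (hQ y) (hT y).1) _)
  have h2 : ∀ y, (P y * Q y ^ (-s)) ^ a = P y ^ a * Q y ^ (1 - a) := fun y => by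
    rw [Real.mul_rpow (hP y) (Real.rpow_nonneg (hQ y) _), ← Real.rpow_mul (hQ y)]
    congr 2
    rw [hs]; field_simp; ring
  have h3 : ∀ y, ((Q y * T y) ^ s) ^ s⁻¹ = Q y * T y := fun y =>
    Real.rpow_rpow_inv (mul_nonneg (hQ y) (hT y).1) hs0.ne'
  simp only [h2, h3, one_div, inv_inv] at h1
  rw [one_div]
  refine le_trans (Finset.sum_le_sum fun y _ => ?_) h1
  rcases (hP y).eq_or_lt with h0 | h0
  · simp [← h0]
  have hQy : 0 < Q y := (hQ y).lt_of_ne' fun h' => h0.ne' (h y h')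
  have hs1 : s ≤ 1 := by rw [hs, div_le_one ha0]; linarith
  rw [Real.mul_rpow hQy.le (hT y).1, mul_assoc, ← mul_assoc (Q y ^ (-s)), ← Real.rpow_add hQy,
    neg_add_cancel, Real.rpow_zero, one_mul]
  refine mul_le_mul_of_nonneg_left ?_ (hP y)
  exact Real.self_le_rpow_of_le_one (hT y).1 (hT y).2 hs1

lemma sum_tensorPow_rpow {ρ σ : X → ℝ} (hρ : ∀ x, 0 ≤ ρ x) (hσ : ∀ x, 0 ≤ σ x) (a : ℝ) (n : ℕ) :
    ∑ x, tensorPow ρ n x ^ a * tensorPow σ n x ^ (1 - a) =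
      (∑ x, ρ x ^ a * σ x ^ (1 - a)) ^ n := by
  rw [← sum_tensorPow]
  refine Finset.sum_congr rfl fun x _ => ?_
  simp only [tensorPow]
  rw [← Real.finsetProd_rpow _ _ (fun i _ => hρ _), ← Real.finsetProd_rpow _ _ (fun i _ => hσ _),
    ← Finset.prod_mul_distrib]

lemma tiltSum_eq {ρ σ : X → ℝ} (hρ : ρ ∈ stdSimplex ℝ X) (hσ : σ ∈ stdSimplex ℝ X)
    (h : SuppLE ρ σ) {t : ℝ} (ht : 0 < t) :
    tiltSum ρ σ t = ∑ x, ρ x ^ (1 + t) * σ x ^ (-t) := by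
  refine Finset.sum_congr rfl fun x _ => ?_
  rcases (hρ.1 x).eq_or_lt with h0 | h0
  · rw [← h0, Real.zero_rpow (by linarith)]; simp
  have hσx : 0 < σ x := (hσ.1 x).lt_of_ne' fun h' => h0.ne' (h x h')
  rw [mul_comm t, ← Real.rpow_def_of_pos (div_pos h0 hσx), Real.div_rpow h0.le hσx.le,
    Real.rpow_add h0, Real.rpow_one, Real.rpow_neg hσx.le]
  ring

lemma renyiDiv_ofReal {ρ σ : X → ℝ} (hρ : ρ ∈ stdSimplex ℝ X) (hσ : σ ∈ stdSimplex ℝ X)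
    (h : SuppLE ρ σ) {t : ℝ} (ht : 0 < t) :
    renyiDiv (ENNReal.ofReal (1 + t)) ρ σ = ((t⁻¹ * Real.log (tiltSum ρ σ t) : ℝ) : EReal) := by
  have h1 : ENNReal.ofReal (1 + t) ≠ 1 := by
    rw [Ne, ENNReal.ofReal_eq_one]; linarith
  have h2 : 1 - (1 + t) = -t := by ring
  rw [renyiDiv, if_neg h1, if_neg ENNReal.ofReal_ne_top, ENNReal.toReal_ofReal (by linarith),
    renyiQ, if_pos (Or.inr h), h2, ← tiltSum_eq hρ hσ h ht, ENNReal.log_ofReal,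
    if_neg (not_le.2 (tiltSum_pos hρ σ t)), add_sub_cancel_left, EReal.coe_mul]

lemma antiFactor_mul_eq {ρ σ : X → ℝ} (hρ : ρ ∈ stdSimplex ℝ X) (hσ : σ ∈ stdSimplex ℝ X)
    (h : SuppLE ρ σ) (r : ℝ) {t : ℝ} (ht : 0 < t) :
    (antiFactor (ENNReal.ofReal (1 + t)) : EReal) *
      ((r : EReal) - renyiDiv (ENNReal.ofReal (1 + t)) ρ σ) =
      ((antiObjective ρ r t σ : ℝ) : EReal) := by
  rw [renyiDiv_ofReal hρ hσ h ht, antiFactor, if_neg ENNReal.ofReal_ne_top,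
    ENNReal.toReal_ofReal (by linarith), ← EReal.coe_sub, ← EReal.coe_mul, antiObjective]
  congr 1
  field_simp
  ring

/-- A bound `ρ^{⊗ n}(T) ≤ e ^ (n k) σ^{⊗ n}(T) ^ s` for all tests turns a type II rate `r` into
the lower bound `s r - k` on the type I rate. -/
lemma coe_le_limsup_rate {p q : ℕ → ℝ} {s k r : ℝ} (hs : 0 ≤ s) (hq : ∀ n, 0 ≤ q n)
    (hpq : ∀ n, p n ≤ Real.exp (n * k) * q n ^ s)
    (hr : (r : EReal) ≤ liminf (fun n => rate n (ENNReal.ofReal (q n))) atTop) :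
    ((s * r - k : ℝ) : EReal) ≤ limsup (fun n => rate n (ENNReal.ofReal (p n))) atTop := by
  refine EReal.ge_of_forall_gt_iff_ge.1 fun z hz => ?_
  rw [EReal.coe_lt_coe_iff] at hz
  set r' := r - (s * r - k - z) / (s + 1) with hr'
  have hr'r : r' < r := by
    have : 0 < (s * r - k - z) / (s + 1) := div_pos (by linarith) (by linarith)
    linarith
  have hzr : z ≤ s * r' - k := by
    have h1 : s * ((s * r - k - z) / (s + 1)) ≤ s * r - k - z := by
      rw [mul_div_assoc', div_le_iff₀ (by linarith)]
      nlinarith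
    rw [hr', mul_sub]
    linarith
  have h1 := eventually_lt_of_lt_liminf ((EReal.coe_lt_coe_iff.2 hr'r).trans_le hr)
    (by isBoundedDefault)
  refine le_limsup_of_frequently_le (Eventually.frequently ?_) (by isBoundedDefault)
  filter_upwards [h1, eventually_gt_atTop 0] with n h2 hn
  rw [le_rate_iff hn]
  have h3 := (le_rate_iff hn).1 h2.le
  have h4 : q n ^ s ≤ Real.exp (-(n * r') * s) := by
    rw [Real.exp_mul]
    exact Real.rpow_le_rpow (hq n) h3 hs
  calc p n ≤ Real.exp (n * k) * q n ^ s := hpq n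
    _ ≤ Real.exp (n * k) * Real.exp (-(n * r') * s) :=
        mul_le_mul_of_nonneg_left h4 (Real.exp_pos _).le
    _ ≤ Real.exp (-(n * z)) := by
        rw [← Real.exp_add, Real.exp_le_exp]
        have := mul_le_mul_of_nonneg_left hzr (Nat.cast_nonneg (α := ℝ) n)
        linarith

lemma coe_sub_le_of_coe_sub_le {r : ℝ} {b D : EReal} (h : (r : EReal) - b ≤ D) :
    (r : EReal) - D ≤ b := by
  induction b with
  | top => exact le_top
  | bot => simp_all
  | coe b =>
    induction D with
    | top => simp
    | bot => exact absurd h (not_le.2 (EReal.bot_lt_coe (r - b)))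
    | coe D =>
      norm_cast at h ⊢
      linarith

/-- The Hoeffding anti-divergence bounds the strong converse exponent of a simple i.i.d. problem
from below. -/
theorem hoeffdingAnti_le_sc {ρ σ : X → ℝ} (hρ : ρ ∈ stdSimplex ℝ X) (hσ : σ ∈ stdSimplex ℝ X)
    (r : ℝ) : hoeffdingAnti r ρ σ ≤ sc r (iidSet {ρ}) (iidSet {σ}) := by
  refine le_iInf fun T => le_iInf fun hT => le_iInf fun hr => iSup₂_le fun α hα => ?_
  simp only [typeII_iidSet_singleton] at hr
  simp only [one_sub_typeI_iidSet_singleton hρ _ (hT _)]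
  have hq : ∀ n, 0 ≤ ∑ x, tensorPow σ n x * T n x := fun n => Finset.sum_nonneg fun x _ =>
    mul_nonneg (tensorPow_nonneg hσ.1 n x) (hT n x).1
  rcases eq_or_ne α 1 with rfl | hα1
  · have h1 := coe_le_limsup_rate (s := 0) (k := 0)
      (p := fun n => ∑ x, tensorPow ρ n x * T n x) le_rfl hq (fun n => by
        rw [mul_zero, Real.exp_zero, Real.rpow_zero, one_mul]
        calc ∑ x, tensorPow ρ n x * T n x ≤ ∑ x, tensorPow ρ n x :=
              Finset.sum_le_sum fun x _ =>
                mul_le_of_le_one_right (tensorPow_nonneg hρ.1 n x) (hT n x).2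
          _ = 1 := by rw [sum_tensorPow, hρ.2, one_pow]) hr
    simpa [antiFactor] using h1
  rcases eq_or_ne α ⊤ with rfl | hαt
  · rw [antiFactor, if_pos rfl, EReal.coe_one, one_mul, renyiDiv, if_neg (by simp), if_pos rfl]
    refine coe_sub_le_of_coe_sub_le (le_iInf₂ fun l hl => ?_)
    refine coe_sub_le_of_coe_sub_le ?_
    have h1 := coe_le_limsup_rate (s := 1) (k := l)
      (p := fun n => ∑ x, tensorPow ρ n x * T n x) zero_le_one hq (fun n => by
        rw [Real.rpow_one, Finset.mul_sum]
        refine Finset.sum_le_sum fun x _ => ?_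
        rw [← mul_assoc]
        refine mul_le_mul_of_nonneg_right ?_ (hT n x).1
        calc tensorPow ρ n x ≤ ∏ i, Real.exp l * σ (x i) :=
              Finset.prod_le_prod (fun i _ => hρ.1 _) fun i _ => hl _
          _ = _ := by
              rw [Finset.prod_mul_distrib, Finset.prod_const, Finset.card_univ, Fintype.card_fin,
                ← Real.exp_nat_mul, tensorPow]) hr
    rw [one_mul, EReal.coe_sub] at h1
    exact h1
  obtain ⟨t, ht, rfl⟩ : ∃ t : ℝ, 0 < t ∧ α = ENNReal.ofReal (1 + t) := by
    refine ⟨α.toReal - 1, ?_, by rw [add_sub_cancel, ENNReal.ofReal_toReal hαt]⟩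
    have h1 : 1 < α := lt_of_le_of_ne hα hα1.symm
    have h2 := (ENNReal.toReal_lt_toReal ENNReal.one_ne_top hαt).2 h1
    rw [ENNReal.toReal_one] at h2
    linarith
  by_cases h : SuppLE ρ σ
  · rw [antiFactor_mul_eq hρ hσ h r ht]
    have hZ := tiltSum_pos hρ σ t
    have h1 := coe_le_limsup_rate (s := t / (1 + t)) (k := Real.log (tiltSum ρ σ t) / (1 + t))
      (p := fun n => ∑ x, tensorPow ρ n x * T n x) (by positivity) hq (fun n => by
        have h2 := sum_mul_test_le (tensorPow_nonneg hρ.1 n) (tensorPow_nonneg hσ.1 n)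
          (h.tensorPow n) (hT n) (a := 1 + t) (by linarith)
        have h3 : 1 - (1 + t) = -t := by ring
        rw [sum_tensorPow_rpow hρ.1 hσ.1, h3, ← tiltSum_eq hρ hσ h ht, add_sub_cancel_left] at h2
        refine h2.trans (le_of_eq ?_)
        congr 1
        rw [← Real.rpow_natCast, ← Real.rpow_mul hZ.le, Real.rpow_def_of_pos hZ]
        congr 1
        ring) hr
    convert h1 using 2
    rw [antiObjective]
    ring
  · have h1 : ¬ ((ENNReal.ofReal (1 + t)).toReal < 1 ∨ SuppLE ρ σ) := by
      rw [ENNReal.toReal_ofReal (by linarith)]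
      exact fun h' => h'.elim (fun h'' => by linarith) h
    have h2 : renyiDiv (ENNReal.ofReal (1 + t)) ρ σ = ⊤ := by
      rw [renyiDiv, if_neg hα1, if_neg hαt, renyiQ, if_neg h1, ENNReal.log_top,
        ENNReal.toReal_ofReal (by linarith), add_sub_cancel_left, EReal.coe_mul_top_of_pos]
      positivity
    have h3 : 0 < antiFactor (ENNReal.ofReal (1 + t)) := by
      rw [antiFactor, if_neg hαt, ENNReal.toReal_ofReal (by linarith)]
      have : 0 < 1 + t := by linarith
      rw [add_sub_cancel_left]
      positivity
    rw [h2, sub_eq_add_neg, EReal.neg_top, EReal.add_bot, EReal.coe_mul_bot_of_pos h3]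
    exact bot_le

/-! ### The Hoeffding anti-divergence against the adversary -/

/-- Against a compact convex set of states, of which at least one dominates `ρ`, the adversarial
strong converse exponent is at most the Hoeffding anti-divergence. -/
theorem sc_advSet_le_hoeffdingAntiSet {ρ : X → ℝ} (hρ : ρ ∈ stdSimplex ℝ X) {C : Set (X → ℝ)}
    (hC : C ⊆ stdSimplex ℝ X) (hcomp : IsCompact C) (hconv : Convex ℝ C)
    {σ₀ : X → ℝ} (hσ₀ : σ₀ ∈ C) (hsupp₀ : SuppLE ρ σ₀) {r : ℝ} (hr : 0 < r) :
    sc r (iidSet {ρ}) (advSet C) ≤ hoeffdingAntiSet r {ρ} C := by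
  have hge : ∀ t : ℝ, 0 < t → ∀ σ ∈ C, SuppLE ρ σ →
      ((antiObjective ρ r t σ : ℝ) : EReal) ≤ hoeffdingAntiSet r {ρ} C := fun t ht σ hσ hs => by
    rw [← antiFactor_mul_eq hρ (hC hσ) hs r ht]
    refine le_iSup₂_of_le ρ rfl (le_iSup₂_of_le σ hσ (le_iSup₂_of_le _ ?_ le_rfl))
    rw [ENNReal.one_le_ofReal]
    linarith
  refine EReal.le_of_forall_lt_iff_le.1 fun z hz => ?_
  obtain ⟨h, hh, hhz⟩ := EReal.lt_iff_exists_real_btwn.1 hz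
  rw [EReal.coe_lt_coe_iff] at hhz
  have hε : 0 < (z - h) / 2 := by linarith
  obtain ⟨τ, hτ, σ, hσ, hτρ, hρσ, hCτ, hle⟩ := exists_tilted_state hρ hC hcomp hconv hσ₀ hsupp₀ hr
    (h := h) (fun t ht σ hσ hs => EReal.coe_le_coe_iff.1 ((hge t ht σ hσ hs).trans hh.le)) hε
  refine (sc_advSet_le hρ hτ hC hσ hτρ hρσ hCτ r hε).trans (EReal.coe_le_coe_iff.2 ?_)
  linarith

end Converse

end CompositeTesting

theorem mainTheorem2 {X : Type*} [Fintype X]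
    (ρ : X → ℝ) (hρ : ρ ∈ stdSimplex ℝ X)
    (S : Set (X → ℝ)) (hS : S ⊆ stdSimplex ℝ X)
    (hD : CompositeTesting.renyiDivSet 1 {ρ} S < CompositeTesting.renyiDivSet ⊤ {ρ} S)
    (r : ℝ) (hr : 0 < r) :
    -- the supremum of the strong converse exponents of the simple i.i.d. problems
    CompositeTesting.hoeffdingAntiSet r {ρ} (CompositeTesting.cco S) =
      (⨆ σ ∈ CompositeTesting.cco S,
        CompositeTesting.sc r (CompositeTesting.iidSet {ρ}) (CompositeTesting.iidSet {σ})) ∧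
    -- adversarial
    CompositeTesting.hoeffdingAntiSet r {ρ} (CompositeTesting.cco S) =
      CompositeTesting.sc r (CompositeTesting.iidSet {ρ})
        (CompositeTesting.advSet (CompositeTesting.cco S)) ∧
    CompositeTesting.hoeffdingAntiSet r {ρ} (CompositeTesting.cco S) =
      CompositeTesting.sc r (CompositeTesting.iidSet {ρ}) (CompositeTesting.advSet S) ∧
    -- arbitrarily varying
    CompositeTesting.hoeffdingAntiSet r {ρ} (CompositeTesting.cco S) =
      CompositeTesting.sc r (CompositeTesting.iidSet {ρ}) (CompositeTesting.avSet S) ∧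
    CompositeTesting.hoeffdingAntiSet r {ρ} (CompositeTesting.cco S) =
      CompositeTesting.sc r (CompositeTesting.iidSet {ρ})
        (CompositeTesting.avSet (CompositeTesting.cco S)) ∧
    -- composite i.i.d.
    CompositeTesting.hoeffdingAntiSet r {ρ} (CompositeTesting.cco S) =
      CompositeTesting.sc r (CompositeTesting.iidSet {ρ})
        (CompositeTesting.iidSet (CompositeTesting.cco S)) ∧
    -- composite i.i.d., relaxed exponent
    CompositeTesting.hoeffdingAntiSet r {ρ} (CompositeTesting.cco S) =
      CompositeTesting.scRelaxedAlt r (CompositeTesting.iidSet {ρ})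
        (fun (σ : CompositeTesting.cco S) (n : ℕ) =>
          CompositeTesting.tensorPow (σ : X → ℝ) n) := by
  open CompositeTesting in
  set C := cco S with hCdef
  have hC : C ⊆ stdSimplex ℝ X :=
    closure_minimal (convexHull_min hS (convex_stdSimplex ℝ X)) (isClosed_stdSimplex ℝ X)
  have hcomp : IsCompact C := (isCompact_stdSimplex ℝ X).of_isClosed_subset isClosed_closure hC
  have hconv : Convex ℝ C := (convex_convexHull ℝ S).closure
  obtain ⟨σ₀, hσ₀, hsupp₀⟩ : ∃ σ ∈ S, SuppLE ρ σ := by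
    by_contra! h
    have h1 : renyiDivSet 1 {ρ} S = ⊤ := by
      simp only [renyiDivSet, Set.mem_singleton_iff, iInf_iInf_eq_left, iInf_eq_top]
      intro σ hσ
      rw [renyiDiv, if_pos rfl, relEntropy, if_neg (h σ hσ)]
    exact not_top_lt (h1 ▸ hD)
  have h1 : hoeffdingAntiSet r {ρ} C ≤ ⨆ σ ∈ C, sc r (iidSet {ρ}) (iidSet {σ}) := by
    refine iSup₂_le ?_
    rintro _ rfl
    exact iSup₂_mono fun σ hσ => hoeffdingAnti_le_sc hρ (hC hσ) r
  have h2 := iSup_sc_le_scRelaxedAlt r (iidSet {ρ}) C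
  have h3 := scRelaxedAlt_le_sc r (iidSet {ρ}) C
  have h4 := sc_mono r (iidSet {ρ}) (iidSet_subset_avSet C)
  have h5 : sc r (iidSet {ρ}) (avSet C) ≤ sc r (iidSet {ρ}) (avSet S) :=
    sc_mono_of_typeII_le r (iidSet {ρ}) (typeII_avSet_cco_le S)
  have h6 := sc_mono r (iidSet {ρ}) (avSet_subset_advSet S)
  have h7 := sc_mono r (iidSet {ρ}) (advSet_mono (subset_cco S))
  have h8 := sc_advSet_le_hoeffdingAntiSet hρ hC hcomp hconv (subset_cco S hσ₀) hsupp₀ hr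
  refine ⟨le_antisymm h1 ?_, le_antisymm ?_ h8, le_antisymm ?_ (h7.trans h8),
    le_antisymm ?_ (h6.trans (h7.trans h8)), le_antisymm ?_ (h5.trans (h6.trans (h7.trans h8))),
    le_antisymm ((h1.trans h2).trans h3) (h4.trans (h5.trans (h6.trans (h7.trans h8)))),
    le_antisymm (h1.trans h2) (h3.trans (h4.trans (h5.trans (h6.trans (h7.trans h8)))))⟩
  · exact h2.trans (h3.trans (h4.trans (h5.trans (h6.trans (h7.trans h8)))))
  · exact h1.trans (h2.trans (h3.trans (h4.trans (h5.trans (h6.trans h7)))))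
  · exact h1.trans (h2.trans (h3.trans (h4.trans (h5.trans h6))))
  · exact h1.trans (h2.trans (h3.trans (h4.trans h5)))
  · exact h1.trans (h2.trans (h3.trans h4))
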